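/- For integers $m\ge 2$ and $1\le \ell\le m$ put $j_m=0$ if $m$ is even and $j_m=1$ if $m$ is odd. Let $\psi_\ell^{(m)}$ be the B-spline framelet of order $m$, i.e. the (continuous) function whose Fourier transform, in the convention $\hat f(\omega)=\int_{\mathbb R} f(x)e^{-i\omega x}\,dx$, is $$\hat\psi_\ell^{(m)}(\omega)=i^\ell e^{-i\omega j_m/2}\sqrt{\binom{m}{\ell}}\;\frac{\cos^{m-\ell}(\omega/4)\,\sin^{m+\ell}(\omega/4)}{(\omega/4)^m};$$ explicitly, $\psi_\ell^{(m)}(x)=\frac1{2\pi}\int_{\mathbb R}\hat\psi_\ell^{(m)}(\omega)e^{i\omega x}\,d\omega$. Let $$G_{m,\ell}(x)=C_{m,\ell}\exp\left(-\frac{12x^2}{2m-\ell}\right),\qquad C_{m,\ell}=\sqrt{\frac6\pi}\,\frac{\sqrt{\binom m\ell}}{\sqrt{m-\ell/2}\;4^\ell},\qquad G_\ell^{(m)}(x)=G_{m,\ell}^{(\ell)}\left(x-\tfrac{j_m}{2}\right),$$ where $G_{m,\ell}^{(\ell)}$ is the $\ell$-th derivative of $G_{m,\ell}$. Then there is an absolute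 constant $C>0$ such that for every integer $m\ge 2$ $$\max_{1\le\ell\le m}\ \max_{x\in\mathbb R}\ \left|\psi_\ell^{(m)}(x)-G_\ell^{(m)}(x)\right|\ \le\ C\,\frac{(\ln m)^{5/2}}{m^{3/2}}$$ (in particular the maximum is attained). -/

import Mathlib

/-- The parity shift `j_m`: `0` for even `m`, `1` for odd `m`. -/
def parityShift (m : ℕ) : ℝ := if Even m then 0 else 1

/-- The function `ω ↦ i^ℓ e^{-iωj_m/2} √(m choose ℓ) cos^{m-ℓ}(ω/4) sin^{m+ℓ}(ω/4) / (ω/4)^m`, the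
Fourier transform (in the convention `f̂(ω) = ∫ f(x) e^{-iωx} dx`) of the `ℓ`-th B-spline framelet
of order `m`. For `1 ≤ ℓ ≤ m` the value `0` that Lean gives at `ω = 0` is the continuous
extension. -/
noncomputable def frameletHat (m ℓ : ℕ) (ω : ℝ) : ℂ :=
  Complex.I ^ ℓ * Complex.exp (-(Complex.I * ω * parityShift m / 2)) *
    ((√(m.choose ℓ : ℝ) * (Real.cos (ω / 4) ^ (m - ℓ) * Real.sin (ω / 4) ^ (m + ℓ) /
      (ω / 4) ^ m) : ℝ) : ℂ)

/-- The `ℓ`-th B-spline framelet of order `m`, the inverse Fourier transform of `frameletHat m ℓ`,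
which is absolutely integrable for `m ≥ 2` (see `integrable_frameletHat`). -/
noncomputable def framelet (m ℓ : ℕ) (x : ℝ) : ℂ :=
  1 / (2 * Real.pi) * ∫ ω : ℝ, frameletHat m ℓ ω * Complex.exp (Complex.I * ω * x)

/-- The scaled Gaussian `C_{m,ℓ} exp(-12 x² / (2m - ℓ))`, with
`C_{m,ℓ} = √(6/π) √(m choose ℓ) / (√(m - ℓ/2) 4^ℓ)`. -/
noncomputable def scaledGaussian (m ℓ : ℕ) (x : ℝ) : ℝ :=
  √(6 / Real.pi) * (√(m.choose ℓ : ℝ) / (√((m : ℝ) - (ℓ : ℝ) / 2) * 4 ^ ℓ)) *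
    Real.exp (-(12 * x ^ 2 / (2 * (m : ℝ) - (ℓ : ℝ))))

/-- The `ℓ`-th derivative of the scaled Gaussian, shifted by `j_m / 2`. -/
noncomputable def gaussianFramelet (m ℓ : ℕ) (x : ℝ) : ℝ :=
  iteratedDeriv ℓ (scaledGaussian m ℓ) (x - parityShift m / 2)

/-- The integral that defines `framelet` converges absolutely for `m ≥ 2`. -/
theorem integrable_frameletHat {m : ℕ} (hm : 2 ≤ m) (ℓ : ℕ) :
    MeasureTheory.Integrable (frameletHat m ℓ) := by
  have hint : MeasureTheory.Integrable
      (fun ω : ℝ => √(m.choose ℓ : ℝ) * (2 * (1 + (ω / 4) ^ 2)⁻¹)) :=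
    ((integrable_inv_one_add_sq.comp_div (by norm_num : (4 : ℝ) ≠ 0)).const_mul 2).const_mul _
  refine hint.mono' ?_ (Filter.Eventually.of_forall fun ω => ?_)
  · unfold frameletHat
    exact Measurable.aestronglyMeasurable (by fun_prop)
  · have hexp : ‖Complex.exp (-(Complex.I * ω * parityShift m / 2))‖ = 1 := by
      rw [show -(Complex.I * (ω : ℂ) * (parityShift m : ℂ) / 2)
        = ((-(ω * parityShift m / 2) : ℝ) : ℂ) * Complex.I by push_cast; ring]
      exact Complex.norm_exp_ofReal_mul_I _
    unfold frameletHat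
    rw [norm_mul, norm_mul, hexp, norm_pow, Complex.norm_I, one_pow, one_mul, one_mul,
      Complex.norm_real, norm_mul, Real.norm_of_nonneg (Real.sqrt_nonneg _)]
    refine mul_le_mul_of_nonneg_left ?_ (Real.sqrt_nonneg _)
    generalize ω / 4 = t
    rw [norm_div, norm_mul, norm_pow, norm_pow, norm_pow, Real.norm_eq_abs, Real.norm_eq_abs,
      Real.norm_eq_abs]
    have hc : |Real.cos t| ^ (m - ℓ) ≤ 1 := pow_le_one₀ (abs_nonneg _) (Real.abs_cos_le_one t)
    have hs1 : |Real.sin t| ≤ 1 := Real.abs_sin_le_one t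
    have hst : |Real.sin t| ≤ |t| := by
      simpa using Real.abs_sin_le_abs (x := t)
    by_cases ht : t = 0
    · subst ht
      have : (|(0 : ℝ)|) ^ m = 0 := by simp; omega
      rw [this, div_zero]
      positivity
    have htp : 0 < |t| := abs_pos.mpr ht
    have h1 : |Real.sin t| ^ (m + ℓ) ≤ |Real.sin t| ^ 2 * |t| ^ (m - 2) := by
      calc |Real.sin t| ^ (m + ℓ) ≤ |Real.sin t| ^ m :=
            pow_le_pow_of_le_one (abs_nonneg _) hs1 (by omega)
        _ = |Real.sin t| ^ 2 * |Real.sin t| ^ (m - 2) := by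
            rw [← pow_add]; congr 1; omega
        _ ≤ _ := by gcongr
    have h2 : |Real.sin t| ^ 2 * (1 + t ^ 2) ≤ 2 * |t| ^ 2 := by
      have a1 : |Real.sin t| ^ 2 ≤ |t| ^ 2 := by gcongr
      have a2 : |Real.sin t| ^ 2 ≤ 1 := pow_le_one₀ (abs_nonneg _) hs1
      rw [← sq_abs t]
      nlinarith [sq_nonneg |t|]
    have h3 : |t| ^ m = |t| ^ 2 * |t| ^ (m - 2) := by
      rw [← pow_add]; congr 1; omega
    rw [div_le_iff₀ (by positivity), ← div_eq_mul_inv, div_mul_eq_mul_div,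
      le_div_iff₀ (by positivity)]
    calc |Real.cos t| ^ (m - ℓ) * |Real.sin t| ^ (m + ℓ) * (1 + t ^ 2)
        ≤ 1 * (|Real.sin t| ^ 2 * |t| ^ (m - 2)) * (1 + t ^ 2) := by gcongr
      _ = (|Real.sin t| ^ 2 * (1 + t ^ 2)) * |t| ^ (m - 2) := by ring
      _ ≤ (2 * |t| ^ 2) * |t| ^ (m - 2) := by gcongr
      _ = 2 * |t| ^ m := by rw [h3]; ring

open MeasureTheory Filter Topology
open scoped FourierTransform

/-! By Fourier inversion the sup norm is controlled by the `L¹` norm of the difference of the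
transforms, which at `ω = 4t` is `symbolDiff` times a unimodular factor. So a majorant of
`symbolDiff`, uniform in `ℓ`, with integral `O(m^{-3/2})` suffices.

For `|t| ≤ 1`, `cos t ≈ e^{-t²/2}` and `sinc t ≈ e^{-t²/6}` give the Gaussian `e^{-(2m-ℓ)t²/3}` with
relative error `m t⁴`. Part of its decay absorbs `√(m choose ℓ) |t|^ℓ`
(`sqrt_choose_mul_abs_pow_mul_exp_le`). What remains, of order `m t⁴ e^{-mt²/12}`, has integral of
order `m^{-3/2}`. For `|t| ≥ 1` the binomial theorem absorbs the coefficient and powers of `sinc`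
decay geometrically in `m`.

The maximum exists because the difference is continuous and vanishes at infinity (Riemann–Lebesgue).
-/

/-! ### Gaussian approximation of `cos` and `sinc` near the origin -/

theorem Real.one_sub_add_sq_div_two_sub_le_exp_neg {u : ℝ} (h0 : 0 ≤ u) (h1 : u ≤ 1) :
    1 - u + u ^ 2 / 2 - 2 / 9 * u ^ 3 ≤ Real.exp (-u) := by
  have h := Real.exp_bound (x := -u) (by rwa [abs_neg, abs_of_nonneg h0]) (n := 3) (by norm_num)
  rw [abs_neg, abs_of_nonneg h0] at h
  have h' := (abs_le.mp h).1
  norm_num [Finset.sum_range_succ, Nat.factorial] at h'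
  linarith

theorem Real.cos_le_exp_neg_sq_div_two {t : ℝ} (ht : |t| ≤ 1) :
    Real.cos t ≤ Real.exp (-(t ^ 2 / 2)) := by
  have hb := (abs_le.mp (Real.cos_bound ht)).2
  have h2 : t ^ 2 ≤ 1 := by rw [← sq_abs]; exact pow_le_one₀ (abs_nonneg t) ht
  have he := Real.one_sub_add_sq_div_two_sub_le_exp_neg (u := t ^ 2 / 2) (by positivity)
    (by linarith)
  have h4 : |t| ^ 4 = (t ^ 2) ^ 2 := by rw [← sq_abs t]; ring
  rw [h4] at hb
  nlinarith [mul_nonneg (sq_nonneg (t ^ 2)) (sub_nonneg.2 h2)]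

theorem Real.sinc_le_exp_neg_sq_div_six {t : ℝ} (ht : |t| ≤ 1) :
    Real.sinc t ≤ Real.exp (-(t ^ 2 / 6)) := by
  wlog h : 0 ≤ t generalizing t
  · simpa using this (t := -t) (by simpa using ht) (by linarith)
  rcases h.eq_or_lt with rfl | hpos
  · simp
  rw [Real.sinc_of_ne_zero hpos.ne', div_le_iff₀ hpos]
  have hb := (abs_le.mp (Real.sin_bound ht)).2
  rw [abs_of_pos hpos] at hb ht
  have h2 : t ^ 2 ≤ 1 := pow_le_one₀ h ht
  have he := Real.one_sub_add_sq_div_two_sub_le_exp_neg (u := t ^ 2 / 6) (by positivity)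
    (by linarith)
  have h5 : 1 - t ^ 2 / 6 + t ^ 4 / 100 ≤ Real.exp (-(t ^ 2 / 6)) := by
    nlinarith [mul_nonneg (sq_nonneg (t ^ 2)) (sub_nonneg.2 h2)]
  nlinarith [mul_le_mul_of_nonneg_right h5 h]

theorem Real.one_sub_sq_div_six_le_sinc (t : ℝ) : 1 - t ^ 2 / 6 ≤ Real.sinc t := by
  wlog h : 0 ≤ t generalizing t
  · simpa using this (-t) (by linarith)
  rcases h.eq_or_lt with rfl | hpos
  · simp
  rw [Real.sinc_of_ne_zero hpos.ne', le_div_iff₀ hpos]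
  linarith [Real.sin_ge_sub_cube h]

theorem one_sub_sq_le_mul_exp {a u : ℝ} (hu : 0 ≤ u) (hu1 : u ≤ 1) (ha : 1 - u ≤ a) :
    1 - u ^ 2 ≤ a * Real.exp u := by
  have := Real.add_one_le_exp u
  nlinarith [mul_le_mul ha this (by linarith) (by linarith)]

/-- Bernoulli's inequality for a product of two powers. -/
theorem one_sub_pow_mul_pow_le {u v : ℝ} (hu : 0 ≤ u) (hu1 : u ≤ 1) (hv : 0 ≤ v) (hv1 : v ≤ 1)
    (p q : ℕ) : 1 - u ^ p * v ^ q ≤ p * (1 - u) + q * (1 - v) := by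
  have h1 := one_add_mul_le_pow (a := u - 1) (by linarith) p
  have h2 := one_add_mul_le_pow (a := v - 1) (by linarith) q
  rw [add_sub_cancel] at h1 h2
  have h3 : u ^ p ≤ 1 := pow_le_one₀ hu hu1
  have h4 : v ^ q ≤ 1 := pow_le_one₀ hv hv1
  nlinarith [mul_nonneg (sub_nonneg.2 h3) (sub_nonneg.2 h4)]

/-- Dividing each factor by its Gaussian leaves `u, v ∈ [0, 1]` with `1 - u ≤ t⁴/4` and `1 - v ≤
t⁴/36`; Bernoulli then bounds the relative error. -/
theorem abs_cos_pow_mul_sinc_pow_sub_exp_le {m ℓ : ℕ} (hl : ℓ ≤ m) {t : ℝ} (ht : |t| ≤ 1) :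
    |Real.cos t ^ (m - ℓ) * Real.sinc t ^ (m + ℓ) - Real.exp (-((2 * m - ℓ) * t ^ 2 / 3))| ≤
      m * t ^ 4 * Real.exp (-((2 * m - ℓ) * t ^ 2 / 3)) := by
  have h2 : t ^ 2 ≤ 1 := by rw [← sq_abs]; exact pow_le_one₀ (abs_nonneg t) ht
  have ht0 : 0 ≤ t ^ 2 := sq_nonneg t
  have hc0 := Real.one_sub_sq_div_two_le_cos (x := t)
  have hs0 := Real.one_sub_sq_div_six_le_sinc t
  have hc1 := Real.cos_le_exp_neg_sq_div_two ht
  have hs1 := Real.sinc_le_exp_neg_sq_div_six ht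
  set u := Real.cos t * Real.exp (t ^ 2 / 2) with hu
  set v := Real.sinc t * Real.exp (t ^ 2 / 6) with hv
  have hu0 : 0 ≤ u := mul_nonneg (by linarith) (Real.exp_pos _).le
  have hv0 : 0 ≤ v := mul_nonneg (by linarith) (Real.exp_pos _).le
  have hu1 : u ≤ 1 := by
    rw [Real.exp_neg] at hc1
    exact (le_inv_mul_iff₀' (Real.exp_pos _)).1 (by simpa using hc1)
  have hv1 : v ≤ 1 := by
    rw [Real.exp_neg] at hs1
    exact (le_inv_mul_iff₀' (Real.exp_pos _)).1 (by simpa using hs1)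
  have hu2 := one_sub_sq_le_mul_exp (u := t ^ 2 / 2) (by positivity) (by linarith) hc0
  have hv2 := one_sub_sq_le_mul_exp (u := t ^ 2 / 6) (by positivity) (by linarith) hs0
  rw [← hu] at hu2
  rw [← hv] at hv2
  have hb := one_sub_pow_mul_pow_le hu0 hu1 hv0 hv1 (m - ℓ) (m + ℓ)
  have hle : u ^ (m - ℓ) * v ^ (m + ℓ) ≤ 1 :=
    mul_le_one₀ (pow_le_one₀ hu0 hu1) (by positivity) (pow_le_one₀ hv0 hv1)
  have hprod : Real.cos t ^ (m - ℓ) * Real.sinc t ^ (m + ℓ) =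
      u ^ (m - ℓ) * v ^ (m + ℓ) * Real.exp (-((2 * m - ℓ) * t ^ 2 / 3)) := by
    have : Real.exp (t ^ 2 / 2) ^ (m - ℓ) * Real.exp (t ^ 2 / 6) ^ (m + ℓ) *
        Real.exp (-((2 * m - ℓ) * t ^ 2 / 3)) = 1 := by
      rw [← Real.exp_nat_mul, ← Real.exp_nat_mul, ← Real.exp_add, ← Real.exp_add, Nat.cast_sub hl,
        Real.exp_eq_one_iff]
      push_cast
      ring
    rw [hu, hv, mul_pow, mul_pow]
    linear_combination (-(Real.cos t ^ (m - ℓ) * Real.sinc t ^ (m + ℓ))) * this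
  have hE := Real.exp_pos (-((2 * m - ℓ) * t ^ 2 / 3))
  rw [hprod, ← sub_one_mul, abs_mul, abs_of_pos hE, abs_sub_comm, abs_of_nonneg (by linarith)]
  gcongr
  refine hb.trans ?_
  have hm : (ℓ : ℝ) ≤ m := by exact_mod_cast hl
  have hm0 : (0 : ℝ) ≤ ℓ := by positivity
  rw [Nat.cast_sub hl]
  push_cast
  have e1 : ((m : ℝ) - ℓ) * (1 - u) ≤ m * (t ^ 4 / 4) :=
    mul_le_mul (by linarith) (by linarith) (by linarith) (by positivity)
  have e2 : ((m : ℝ) + ℓ) * (1 - v) ≤ (2 * m) * (t ^ 4 / 36) :=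
    mul_le_mul (by linarith) (by linarith) (by linarith) (by positivity)
  have : 0 ≤ m * t ^ 4 := by positivity
  linarith

/-! ### Absorbing the binomial coefficient -/

theorem choose_mul_sin_pow_mul_cos_pow_le_one {m ℓ : ℕ} (hl : ℓ ≤ m) (t : ℝ) :
    m.choose ℓ * ((Real.sin t ^ 2) ^ ℓ * (Real.cos t ^ 2) ^ (m - ℓ)) ≤ 1 := by
  have h := add_pow (Real.sin t ^ 2) (Real.cos t ^ 2) m
  rw [Real.sin_sq_add_cos_sq, one_pow] at h
  rw [h, mul_comm]
  exact Finset.single_le_sum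
    (f := fun k => (Real.sin t ^ 2) ^ k * (Real.cos t ^ 2) ^ (m - k) * (m.choose k : ℝ))
    (fun i _ => by positivity) (Finset.mem_range_succ_iff.2 hl)

theorem sqrt_choose_mul_abs_sin_pow_mul_cos_pow_le_one {m ℓ : ℕ} (hl : ℓ ≤ m) (t : ℝ) :
    √(m.choose ℓ : ℝ) * |Real.sin t ^ ℓ * Real.cos t ^ (m - ℓ)| ≤ 1 := by
  rw [← Real.sqrt_sq_eq_abs, ← Real.sqrt_mul (by positivity),
    Real.sqrt_le_iff, one_pow]
  refine ⟨zero_le_one, ?_⟩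
  convert choose_mul_sin_pow_mul_cos_pow_le_one hl t using 2
  rw [mul_pow]
  ring

/-- The arithmetic-geometric mean bound for falling factorials. -/
theorem cast_descFactorial_le {m ℓ : ℕ} (hl : ℓ ≤ m) :
    (m.descFactorial ℓ : ℝ) ≤ ((2 * m - ℓ + 1) / 2) ^ ℓ := by
  have hm : (ℓ : ℝ) ≤ m := by exact_mod_cast hl
  have h : (m.descFactorial ℓ : ℝ) = ∏ i ∈ Finset.range ℓ, ((m : ℝ) - i) := by
    rw [Nat.descFactorial_eq_prod_range]
    push_cast
    refine Finset.prod_congr rfl fun i hi => ?_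
    rw [Nat.cast_sub (by have := Finset.mem_range.1 hi; omega)]
  -- The reversed product pairs factors with constant sum `2m - ℓ + 1`.
  have h' : (m.descFactorial ℓ : ℝ) = ∏ i ∈ Finset.range ℓ, ((m : ℝ) - ℓ + 1 + i) := by
    rw [h, ← Finset.prod_range_reflect]
    refine Finset.prod_congr rfl fun i hi => ?_
    have := Finset.mem_range.1 hi
    rw [Nat.sub_sub, Nat.cast_sub (by omega)]
    push_cast
    ring
  refine le_of_sq_le_sq ?_ (by apply pow_nonneg; linarith)
  calc (m.descFactorial ℓ : ℝ) ^ 2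
      = ∏ i ∈ Finset.range ℓ, (((m : ℝ) - i) * ((m : ℝ) - ℓ + 1 + i)) := by
        rw [Finset.prod_mul_distrib, ← h, ← h', sq]
    _ ≤ ∏ _i ∈ Finset.range ℓ, (((2 * m - ℓ + 1) / 2) ^ 2 : ℝ) := by
        refine Finset.prod_le_prod (fun i hi => ?_) fun i hi => ?_
        · have hi' : (i : ℝ) ≤ ℓ := by exact_mod_cast (Finset.mem_range.1 hi).le
          have hi0 : (0 : ℝ) ≤ i := by positivity
          exact mul_nonneg (by linarith) (by linarith)
        · nlinarith [sq_nonneg (((m : ℝ) - i) - ((m : ℝ) - ℓ + 1 + i))]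
    _ = _ := by rw [Finset.prod_const, Finset.card_range, pow_right_comm]

/-- Dropping the `+ 1` in the mean costs `(1 + 1/(2m-ℓ))^ℓ ≤ e`, since `ℓ ≤ 2m - ℓ`. -/
theorem cast_choose_le {m ℓ : ℕ} (hm : 1 ≤ m) (hl : ℓ ≤ m) :
    (m.choose ℓ : ℝ) ≤ Real.exp 1 * (((2 * m - ℓ) / 2) ^ ℓ / ℓ.factorial) := by
  have hlm : (ℓ : ℝ) ≤ m := by exact_mod_cast hl
  have hm1 : (1 : ℝ) ≤ m := by exact_mod_cast hm
  have hN : (0 : ℝ) < 2 * m - ℓ := by linarith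
  rw [← mul_div_assoc, le_div_iff₀ (by positivity)]
  have h1 : (m.choose ℓ : ℝ) * ℓ.factorial = m.descFactorial ℓ := by
    rw [Nat.descFactorial_eq_factorial_mul_choose]
    push_cast
    ring
  have h2 : (2 * m - ℓ + 1) / 2 = (1 / (2 * m - ℓ) + 1) * ((2 * m - ℓ) / 2 : ℝ) := by
    field_simp
    ring
  rw [h1]
  refine (cast_descFactorial_le hl).trans ?_
  rw [h2, mul_pow]
  gcongr
  calc (1 / (2 * m - ℓ) + 1 : ℝ) ^ ℓ ≤ Real.exp (1 / (2 * m - ℓ)) ^ ℓ := by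
        gcongr
        exact Real.add_one_le_exp _
    _ = Real.exp (ℓ * (1 / (2 * m - ℓ))) := (Real.exp_nat_mul _ _).symm
    _ ≤ Real.exp 1 := by
        gcongr
        rw [mul_one_div, div_le_one hN]
        linarith

/-- With `N = 2m - ℓ`, `x^ℓ/ℓ! ≤ e^x` at `x = Nt²/2` bounds the prefactor by `√e · e^{Nt²/4}`. As
`1/3 - 1/4 = 1/12` and `N ≥ m`, decay survives uniformly in `ℓ`. -/
theorem sqrt_choose_mul_abs_pow_mul_exp_le {m ℓ : ℕ} (hm : 1 ≤ m) (hl : ℓ ≤ m) (t : ℝ) :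
    √(m.choose ℓ : ℝ) * |t| ^ ℓ * Real.exp (-((2 * m - ℓ) * t ^ 2 / 3)) ≤
      2 * Real.exp (-(m * t ^ 2 / 12)) := by
  have hlm : (ℓ : ℝ) ≤ m := by exact_mod_cast hl
  have hc : (m.choose ℓ : ℝ) * (t ^ 2) ^ ℓ ≤
      Real.exp 1 * Real.exp ((2 * m - ℓ) / 2 * t ^ 2) := by
    calc (m.choose ℓ : ℝ) * (t ^ 2) ^ ℓ
        ≤ Real.exp 1 * (((2 * m - ℓ) / 2) ^ ℓ / ℓ.factorial) * (t ^ 2) ^ ℓ := by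
          gcongr
          exact cast_choose_le hm hl
      _ = Real.exp 1 * (((2 * m - ℓ) / 2 * t ^ 2) ^ ℓ / ℓ.factorial) := by rw [mul_pow]; ring
      _ ≤ _ := by
          gcongr
          exact Real.pow_div_factorial_le_exp _ (mul_nonneg (by linarith) (sq_nonneg t)) _
  refine le_of_sq_le_sq ?_ (by positivity)
  rw [mul_pow, mul_pow, Real.sq_sqrt (by positivity), ← pow_mul, mul_comm ℓ 2, pow_mul, sq_abs,
    mul_pow, ← Real.exp_nat_mul, ← Real.exp_nat_mul]
  calc _ ≤ Real.exp 1 * Real.exp ((2 * m - ℓ) / 2 * t ^ 2) *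
        Real.exp ((2 : ℕ) * -((2 * m - ℓ) * t ^ 2 / 3)) := by gcongr
    _ = Real.exp 1 * Real.exp (-((2 * m - ℓ) * t ^ 2 / 6)) := by
        rw [mul_assoc, ← Real.exp_add]
        congr 2
        push_cast
        ring
    _ ≤ 2 ^ 2 * Real.exp ((2 : ℕ) * -(m * t ^ 2 / 12)) := by
        gcongr
        · linarith [Real.exp_one_lt_d9]
        · push_cast
          nlinarith [mul_nonneg (sub_nonneg.2 hlm) (sq_nonneg t)]

/-! ### Pointwise bounds for the difference of symbols -/

theorem Real.abs_sinc_le_of_one_le_abs {t : ℝ} (ht : 1 ≤ |t|) : |Real.sinc t| ≤ 9 / 10 := by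
  wlog h : 0 ≤ t generalizing t
  · simpa using this (t := -t) (by simpa using ht) (by linarith)
  rw [abs_of_nonneg h] at ht
  have hpos : 0 < t := by linarith
  rw [Real.sinc_of_ne_zero hpos.ne', abs_div, abs_of_pos hpos, div_le_iff₀ hpos]
  rcases le_total t 2 with h2 | h2
  -- On `[1, 2]`, `sinc t = sinc (t/2) cos (t/2) ≤ cos (1/2)`.
  · have hc : Real.cos (t / 2) ≤ 9 / 10 := by
      have h1 : Real.cos (t / 2) ≤ Real.cos (1 / 2) :=
        Real.cos_le_cos_of_nonneg_of_le_pi (by norm_num) (by linarith [Real.pi_gt_three])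
          (by linarith)
      have h3 := (abs_le.mp (Real.cos_bound (x := 1 / 2) (by norm_num [abs_of_pos]))).2
      norm_num [abs_of_pos] at h1 h3 ⊢
      linarith
    have hs : 0 ≤ Real.sin t :=
      Real.sin_nonneg_of_nonneg_of_le_pi h (by linarith [Real.pi_gt_three])
    have hs2 := Real.sin_le (x := t / 2) (by linarith)
    have hs3 : 0 ≤ Real.sin (t / 2) :=
      Real.sin_nonneg_of_nonneg_of_le_pi (by linarith) (by linarith [Real.pi_gt_three])
    rw [abs_of_nonneg hs]
    have : Real.sin t = 2 * Real.sin (t / 2) * Real.cos (t / 2) := by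
      rw [← Real.sin_two_mul]
      congr 1
      ring
    rw [this]
    nlinarith [mul_le_mul_of_nonneg_left hc hs3]
  · linarith [Real.abs_sin_le_one t]

/-- `√(m choose ℓ) (cos^{m-ℓ}(t) sin^{m+ℓ}(t) / t^m - t^ℓ exp(-(2m-ℓ)t²/3))`, the difference of the
Fourier transforms of framelet and Gaussian at `4t`, up to a unimodular factor. -/
noncomputable def symbolDiff (m ℓ : ℕ) (t : ℝ) : ℝ :=
  √(m.choose ℓ : ℝ) * (Real.cos t ^ (m - ℓ) * Real.sin t ^ (m + ℓ) / t ^ m -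
    t ^ ℓ * Real.exp (-((2 * m - ℓ) * t ^ 2 / 3)))

/-- At `t = 0` both sides vanish because `ℓ ≥ 1`. -/
theorem cos_pow_mul_sin_pow_div_pow {m ℓ : ℕ} (hl : 1 ≤ ℓ) (t : ℝ) :
    Real.cos t ^ (m - ℓ) * Real.sin t ^ (m + ℓ) / t ^ m =
      t ^ ℓ * (Real.cos t ^ (m - ℓ) * Real.sinc t ^ (m + ℓ)) := by
  rcases eq_or_ne t 0 with rfl | ht
  · rw [Real.sin_zero, zero_pow (by omega), zero_pow (n := ℓ) (by omega)]
    simp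
  · rw [Real.sinc_of_ne_zero ht, div_pow]
    field_simp
    ring

theorem abs_symbolDiff_le_of_abs_le_one {m ℓ : ℕ} (hm : 1 ≤ m) (h1 : 1 ≤ ℓ) (hl : ℓ ≤ m) {t : ℝ}
    (ht : |t| ≤ 1) :
    |symbolDiff m ℓ t| ≤ 2 * (m * t ^ 4 * Real.exp (-(m * t ^ 2 / 12))) := by
  rw [symbolDiff, cos_pow_mul_sin_pow_div_pow h1, ← mul_sub, abs_mul, abs_mul, abs_pow,
    abs_of_nonneg (Real.sqrt_nonneg _), ← mul_assoc]
  calc _ ≤ √(m.choose ℓ : ℝ) * |t| ^ ℓ *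
        (m * t ^ 4 * Real.exp (-((2 * m - ℓ) * t ^ 2 / 3))) := by
        gcongr
        exact abs_cos_pow_mul_sinc_pow_sub_exp_le hl ht
    _ = m * t ^ 4 *
        (√(m.choose ℓ : ℝ) * |t| ^ ℓ * Real.exp (-((2 * m - ℓ) * t ^ 2 / 3))) := by ring
    _ ≤ m * t ^ 4 * (2 * Real.exp (-(m * t ^ 2 / 12))) := by
        exact mul_le_mul_of_nonneg_left (sqrt_choose_mul_abs_pow_mul_exp_le hm hl t)
          (by positivity)
    _ = _ := by ring

theorem sqrt_choose_mul_abs_framelet_symbol_le {m ℓ : ℕ} (hm : 2 ≤ m) (hl : ℓ ≤ m) {t : ℝ}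
    (ht : 1 ≤ |t|) :
    √(m.choose ℓ : ℝ) * |Real.cos t ^ (m - ℓ) * Real.sin t ^ (m + ℓ) / t ^ m| ≤
      2 * (9 / 10) ^ (m - 2) * (1 + t ^ 2)⁻¹ := by
  have ht0 : t ≠ 0 := by
    rintro rfl
    norm_num at ht
  have ht2 : 1 ≤ t ^ 2 := by
    rw [← sq_abs]
    exact one_le_pow₀ ht
  -- Two factors `sinc` are kept for integrability; the other `m - 2` give geometric decay.
  have e : Real.cos t ^ (m - ℓ) * Real.sin t ^ (m + ℓ) / t ^ m =
      (Real.sin t ^ ℓ * Real.cos t ^ (m - ℓ)) * (Real.sinc t ^ (m - 2) * Real.sinc t ^ 2) := by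
    rw [← pow_add, Nat.sub_add_cancel hm, Real.sinc_of_ne_zero ht0, div_pow, pow_add]
    ring
  rw [e, abs_mul, ← mul_assoc]
  have h2 : |Real.sinc t ^ (m - 2) * Real.sinc t ^ 2| ≤
      (9 / 10) ^ (m - 2) * (2 * (1 + t ^ 2)⁻¹) := by
    rw [abs_mul, abs_pow, abs_of_nonneg (sq_nonneg (Real.sinc t))]
    gcongr
    · exact Real.abs_sinc_le_of_one_le_abs ht
    · rw [Real.sinc_of_ne_zero ht0, div_pow, ← div_eq_mul_inv]
      rw [div_le_div_iff₀ (by positivity) (by positivity)]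
      nlinarith [Real.sin_sq_le_one t, sq_nonneg (Real.sin t)]
  calc _ ≤ 1 * ((9 / 10) ^ (m - 2) * (2 * (1 + t ^ 2)⁻¹)) := by
        gcongr
        exact sqrt_choose_mul_abs_sin_pow_mul_cos_pow_le_one hl t
    _ = _ := by ring

theorem abs_symbolDiff_le {m ℓ : ℕ} (hm : 2 ≤ m) (h1 : 1 ≤ ℓ) (hl : ℓ ≤ m) (t : ℝ) :
    |symbolDiff m ℓ t| ≤ 2 * (m * t ^ 4 * Real.exp (-(m * t ^ 2 / 12))) +
      2 * (9 / 10) ^ (m - 2) * (1 + t ^ 2)⁻¹ := by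
  rcases le_total |t| 1 with ht | ht
  · exact (abs_symbolDiff_le_of_abs_le_one (by omega) h1 hl ht).trans
      (le_add_of_nonneg_right (by positivity))
  -- This lets the first majorant also cover the Gaussian's own tail.
  have hmt : 1 ≤ m * t ^ 4 := by
    have : 1 ≤ t ^ 4 := by
      rw [← Even.pow_abs (by decide)]
      exact one_le_pow₀ ht
    exact one_le_mul_of_one_le_of_one_le (by exact_mod_cast (by omega : 1 ≤ m)) this
  rw [symbolDiff, mul_sub]
  refine (abs_sub _ _).trans ((add_le_add ?_ ?_).trans_eq (add_comm _ _))
  · rw [abs_mul, abs_of_nonneg (Real.sqrt_nonneg _)]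
    exact sqrt_choose_mul_abs_framelet_symbol_le hm hl ht
  · rw [abs_mul, abs_mul, abs_of_nonneg (Real.sqrt_nonneg _), abs_of_pos (Real.exp_pos _), abs_pow,
      ← mul_assoc]
    refine (sqrt_choose_mul_abs_pow_mul_exp_le (by omega) hl t).trans ?_
    exact mul_le_mul_of_nonneg_left (le_mul_of_one_le_left (Real.exp_pos _).le hmt) two_pos.le

/-! ### The majorant and its integral -/

/-- Half of the exponent absorbs `t⁴`: `x²/2 ≤ e^x` at `x = at²/24`, whence `1152 = 2 · 24²`. -/
theorem mul_pow_four_mul_exp_le {a : ℝ} (ha : 0 < a) (t : ℝ) :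
    a * t ^ 4 * Real.exp (-(a * t ^ 2 / 12)) ≤ 1152 / a * Real.exp (-(a / 24) * t ^ 2) := by
  have h := Real.pow_div_factorial_le_exp (a * t ^ 2 / 24) (by positivity) 2
  have e : Real.exp (-(a * t ^ 2 / 12)) =
      Real.exp (-(a / 24) * t ^ 2) * Real.exp (-(a * t ^ 2 / 24)) := by
    rw [← Real.exp_add]
    congr 1
    ring
  have h2 : a * t ^ 4 * Real.exp (-(a * t ^ 2 / 24)) ≤ 1152 / a := by
    rw [Real.exp_neg, ← div_eq_mul_inv, div_le_div_iff₀ (Real.exp_pos _) ha]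
    norm_num [Nat.factorial] at h
    nlinarith
  calc _ = (a * t ^ 4 * Real.exp (-(a * t ^ 2 / 24))) * Real.exp (-(a / 24) * t ^ 2) := by
        rw [e]
        ring
    _ ≤ _ := by gcongr

/-- An integrable majorant of `symbolDiff m ℓ`, uniform in `ℓ`. -/
noncomputable def symbolMajorant (m : ℕ) (t : ℝ) : ℝ :=
  2304 / m * Real.exp (-(m / 24) * t ^ 2) + 2 * (9 / 10) ^ (m - 2) * (1 + t ^ 2)⁻¹

theorem abs_symbolDiff_le_symbolMajorant {m ℓ : ℕ} (hm : 2 ≤ m) (h1 : 1 ≤ ℓ) (hl : ℓ ≤ m) (t : ℝ) :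
    |symbolDiff m ℓ t| ≤ symbolMajorant m t := by
  have := mul_pow_four_mul_exp_le (a := m) (by exact_mod_cast (by omega : 0 < m)) t
  refine (abs_symbolDiff_le hm h1 hl t).trans ?_
  rw [symbolMajorant]
  linarith [show 2304 / m * Real.exp (-(m / 24) * t ^ 2) =
    2 * (1152 / m * Real.exp (-(m / 24) * t ^ 2)) by ring]

theorem integrable_symbolMajorant {m : ℕ} (hm : 2 ≤ m) : Integrable (symbolMajorant m) := by
  have hm0 : (0 : ℝ) < m := by exact_mod_cast (by omega : 0 < m)
  exact ((integrable_exp_neg_mul_sq (by positivity)).const_mul _).add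
    (integrable_inv_one_add_sq.const_mul _)

theorem integrable_symbolDiff {m ℓ : ℕ} (hm : 2 ≤ m) (h1 : 1 ≤ ℓ) (hl : ℓ ≤ m) :
    Integrable (symbolDiff m ℓ) := by
  refine (integrable_symbolMajorant hm).mono' ?_
    (Eventually.of_forall (abs_symbolDiff_le_symbolMajorant hm h1 hl))
  unfold symbolDiff
  exact Measurable.aestronglyMeasurable (by fun_prop)

theorem rpow_three_halves_mul_nine_tenths_pow_le {m : ℕ} (hm : 2 ≤ m) :
    (9 / 10 : ℝ) ^ (m - 2) ≤ 400 / (m : ℝ) ^ (3 / 2 : ℝ) := by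
  have hm1 : (1 : ℝ) ≤ m := by exact_mod_cast (by omega : 1 ≤ m)
  have h1 : (9 / 10 : ℝ) ^ m ≤ 200 / (m : ℝ) ^ 2 := by
    have h := Real.pow_div_factorial_le_exp ((m : ℝ) / 10) (by positivity) 2
    norm_num [Nat.factorial] at h
    calc (9 / 10 : ℝ) ^ m ≤ Real.exp (-(1 / 10)) ^ m := by
          gcongr
          linarith [Real.add_one_le_exp (-(1 / 10) : ℝ)]
      _ = (Real.exp (m / 10))⁻¹ := by
          rw [← Real.exp_nat_mul, ← Real.exp_neg]
          congr 1
          ring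
      _ ≤ 200 / (m : ℝ) ^ 2 := by
          rw [inv_eq_one_div, div_le_div_iff₀ (Real.exp_pos _) (by positivity)]
          nlinarith
  have h2 : (9 / 10 : ℝ) ^ (m - 2) * (9 / 10) ^ 2 = (9 / 10) ^ m := by
    rw [← pow_add, Nat.sub_add_cancel hm]
  have h3 : (m : ℝ) ^ (3 / 2 : ℝ) ≤ (m : ℝ) ^ 2 := by
    rw [← Real.rpow_natCast]
    exact Real.rpow_le_rpow_of_exponent_le hm1 (by norm_num)
  have h4 : 200 / (m : ℝ) ^ 2 ≤ 200 / (m : ℝ) ^ (3 / 2 : ℝ) := by gcongr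
  have h5 : 0 ≤ 200 / (m : ℝ) ^ (3 / 2 : ℝ) := by positivity
  have h6 : 400 / (m : ℝ) ^ (3 / 2 : ℝ) = 2 * (200 / (m : ℝ) ^ (3 / 2 : ℝ)) := by ring
  linarith

theorem integral_symbolMajorant_le {m : ℕ} (hm : 2 ≤ m) :
    ∫ t, symbolMajorant m t ≤
      (2304 * √(Real.pi * 24) + 800 * Real.pi) / (m : ℝ) ^ (3 / 2 : ℝ) := by
  have hm0 : (0 : ℝ) < m := by exact_mod_cast (by omega : 0 < m)
  have h := rpow_three_halves_mul_nine_tenths_pow_le hm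
  unfold symbolMajorant
  rw [integral_add ((integrable_exp_neg_mul_sq (by positivity)).const_mul _)
    (integrable_inv_one_add_sq.const_mul _), integral_const_mul, integral_const_mul,
    integral_gaussian, integral_univ_inv_one_add_sq, add_div]
  refine add_le_add (le_of_eq ?_) ?_
  · have : (m : ℝ) ^ (3 / 2 : ℝ) = m * √m := by
      rw [Real.sqrt_eq_rpow, ← Real.rpow_one_add' hm0.le (by norm_num)]
      norm_num
    rw [this, div_div_eq_mul_div, Real.sqrt_div (by positivity)]
    field_simp
  · calc _ ≤ 2 * (400 / (m : ℝ) ^ (3 / 2 : ℝ)) * Real.pi := by gcongr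
      _ = _ := by ring

/-! ### Fourier representation of the difference -/

/-- The substitution `ω = -2πv` passes to the normalisation of `𝓕`. -/
theorem inverse_fourier_integral_eq_fourier (f : ℝ → ℂ) (x : ℝ) :
    1 / (2 * Real.pi) * ∫ ω : ℝ, f ω * Complex.exp (Complex.I * ω * x) =
      𝓕 (fun v : ℝ => f (-2 * Real.pi * v)) x := by
  have h := Measure.integral_comp_mul_left
    (fun ω : ℝ => f ω * Complex.exp (Complex.I * ω * x)) (-2 * Real.pi)
  have ha : |(-2 * Real.pi)⁻¹| = 1 / (2 * Real.pi) := by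
    rw [abs_inv, neg_mul, abs_neg, abs_of_pos (by positivity), one_div]
  rw [ha, Complex.real_smul] at h
  push_cast at h
  rw [← h, Real.fourier_real_eq_integral_exp_smul]
  refine integral_congr_ae (Eventually.of_forall fun v => ?_)
  simp only [smul_eq_mul]
  rw [mul_comm]
  congr 2
  push_cast
  ring

theorem iteratedDeriv_ofReal_comp {f : ℝ → ℝ} {n : ℕ} (hf : ContDiff ℝ n f) (x : ℝ) :
    iteratedDeriv n (fun y => (f y : ℂ)) x = (iteratedDeriv n f x : ℝ) := by
  rw [iteratedDeriv_eq_iteratedFDeriv, iteratedDeriv_eq_iteratedFDeriv]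
  have := Complex.ofRealCLM.iteratedFDeriv_comp_left (x := x) hf.contDiffAt (i := n) le_rfl
  change iteratedFDeriv ℝ n (Complex.ofRealCLM ∘ f) x _ = _
  rw [this]
  rfl

theorem contDiff_scaledGaussian (m ℓ : ℕ) {n : WithTop ℕ∞} : ContDiff ℝ n (scaledGaussian m ℓ) := by
  unfold scaledGaussian
  fun_prop

theorem integrable_pow_smul_gaussian {b : ℝ} (hb : 0 < b) (n : ℕ) :
    Integrable (fun x : ℝ => x ^ n • Complex.exp (-Real.pi * b * x ^ 2)) := by
  have h := (integrable_rpow_mul_exp_neg_mul_sq (b := Real.pi * b) (by positivity)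
    (s := n) (by linarith [Nat.cast_nonneg (α := ℝ) n])).ofReal (𝕜 := ℂ)
  refine h.congr (Eventually.of_forall fun x => ?_)
  simp [Real.rpow_natCast]

/-- The width `b = π(2m-ℓ)/12` makes `πbv²` equal `(2m-ℓ)(ω/4)²/3` at `ω = -2πv`. -/
theorem ofReal_scaledGaussian_eq {m ℓ : ℕ} (hm : 1 ≤ m) (hl : ℓ ≤ m) :
    (fun x : ℝ => (scaledGaussian m ℓ x : ℂ)) = fun x : ℝ =>
      ((√(m.choose ℓ : ℝ) / 4 ^ ℓ : ℝ) : ℂ) *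
        𝓕 (fun v : ℝ => Complex.exp
          (-Real.pi * (Real.pi * (2 * m - ℓ) / 12 : ℝ) * v ^ 2)) x := by
  have hlm : (ℓ : ℝ) ≤ m := by exact_mod_cast hl
  have hm1 : (1 : ℝ) ≤ m := by exact_mod_cast hm
  have hN : (0 : ℝ) < 2 * m - ℓ := by linarith
  have hb : (0 : ℝ) < Real.pi * (2 * m - ℓ) / 12 := by positivity
  ext x
  rw [fourier_gaussian_pi (by simpa only [Complex.ofReal_re] using hb)]
  have h1 : ((Real.pi * (2 * m - ℓ) / 12 : ℝ) : ℂ) ^ (1 / 2 : ℂ) =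
      (√(Real.pi * (2 * m - ℓ) / 12) : ℝ) := by
    rw [Real.sqrt_eq_rpow, Complex.ofReal_cpow hb.le]
    norm_num
  have h2 : Complex.exp (-Real.pi / (Real.pi * (2 * m - ℓ) / 12 : ℝ) * x ^ 2) =
      (Real.exp (-(12 * x ^ 2 / (2 * (m : ℝ) - ℓ))) : ℝ) := by
    rw [Complex.ofReal_exp]
    congr 1
    rw [← Complex.ofReal_neg, ← Complex.ofReal_div, ← Complex.ofReal_pow, ← Complex.ofReal_mul]
    congr 1
    field_simp
  have h3 : √(6 / Real.pi) / √((m : ℝ) - ℓ / 2) = 1 / √(Real.pi * (2 * m - ℓ) / 12) := by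
    rw [← Real.sqrt_div (by positivity), ← Real.sqrt_one, ← Real.sqrt_div one_pos.le]
    congr 1
    have : (m : ℝ) - ℓ / 2 = (2 * m - ℓ) / 2 := by ring
    rw [this]
    field_simp
    norm_num
  simp only [h1, h2]
  rw [scaledGaussian, ← Complex.ofReal_one, ← Complex.ofReal_div, ← h3]
  push_cast
  ring

theorem ofReal_iteratedDeriv_scaledGaussian {m ℓ : ℕ} (hm : 1 ≤ m) (hl : ℓ ≤ m) (x : ℝ) :
    ((iteratedDeriv ℓ (scaledGaussian m ℓ) x : ℝ) : ℂ) =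
      1 / (2 * Real.pi) * ∫ ω : ℝ, Complex.I ^ ℓ *
        ((√(m.choose ℓ : ℝ) * ((ω / 4) ^ ℓ * Real.exp (-((2 * m - ℓ) * (ω / 4) ^ 2 / 3))) : ℝ) : ℂ)
          * Complex.exp (Complex.I * ω * x) := by
  have hlm : (ℓ : ℝ) ≤ m := by exact_mod_cast hl
  have hm1 : (1 : ℝ) ≤ m := by exact_mod_cast hm
  have hN : (0 : ℝ) < 2 * m - ℓ := by linarith
  have hb : (0 : ℝ) < Real.pi * (2 * m - ℓ) / 12 := by positivity
  rw [← iteratedDeriv_ofReal_comp (contDiff_scaledGaussian m ℓ), ofReal_scaledGaussian_eq hm hl,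
    iteratedDeriv_const_mul_field, Real.iteratedDeriv_fourier (N := ⊤)
      (fun n _ => integrable_pow_smul_gaussian hb n) le_top,
    inverse_fourier_integral_eq_fourier, Real.fourier_real_eq_integral_exp_smul,
    Real.fourier_real_eq_integral_exp_smul, ← integral_const_mul]
  refine integral_congr_ae (Eventually.of_forall fun v => ?_)
  simp only [smul_eq_mul]
  have : Complex.exp (-Real.pi * (Real.pi * (2 * m - ℓ) / 12 : ℝ) * v ^ 2) =
      (Real.exp (-((2 * m - ℓ) * (-2 * Real.pi * v / 4) ^ 2 / 3)) : ℝ) := by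
    rw [Complex.ofReal_exp]
    congr 1
    push_cast
    ring
  rw [this]
  push_cast
  rw [div_pow _ _ ℓ, show (-2 * Real.pi * Complex.I * v : ℂ) = Complex.I * (-2 * Real.pi * v) by ring,
    mul_pow Complex.I]
  ring

/-- The Fourier transform of the difference of the framelet and its Gaussian approximation. -/
noncomputable def frameletDiffHat (m ℓ : ℕ) (ω : ℝ) : ℂ :=
  Complex.I ^ ℓ * Complex.exp (-(Complex.I * ω * parityShift m / 2)) *
    (symbolDiff m ℓ (ω / 4) : ℂ)

theorem norm_frameletDiffHat (m ℓ : ℕ) (ω : ℝ) :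
    ‖frameletDiffHat m ℓ ω‖ = |symbolDiff m ℓ (ω / 4)| := by
  rw [frameletDiffHat, show -(Complex.I * (ω : ℂ) * (parityShift m : ℂ) / 2)
    = ((-(ω * parityShift m / 2) : ℝ) : ℂ) * Complex.I by push_cast; ring, norm_mul, norm_mul,
    Complex.norm_exp_ofReal_mul_I, norm_pow, Complex.norm_I, one_pow, one_mul, one_mul,
    Complex.norm_real, Real.norm_eq_abs]

theorem integrable_frameletDiffHat {m ℓ : ℕ} (hm : 2 ≤ m) (h1 : 1 ≤ ℓ) (hl : ℓ ≤ m) :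
    Integrable (frameletDiffHat m ℓ) := by
  refine ((integrable_symbolDiff hm h1 hl).comp_div four_ne_zero).mono ?_
    (Eventually.of_forall fun ω => (norm_frameletDiffHat m ℓ ω).le)
  unfold frameletDiffHat symbolDiff
  exact Measurable.aestronglyMeasurable (by fun_prop)

theorem MeasureTheory.Integrable.mul_exp_I_mul {f : ℝ → ℂ} (hf : Integrable f) (x : ℝ) :
    Integrable fun ω : ℝ => f ω * Complex.exp (Complex.I * ω * x) := by
  refine hf.mono (hf.aestronglyMeasurable.mul (Measurable.aestronglyMeasurable (by fun_prop)))
    (Eventually.of_forall fun ω => ?_)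
  rw [norm_mul, show Complex.I * (ω : ℂ) * x = ((ω * x : ℝ) : ℂ) * Complex.I by push_cast; ring,
    Complex.norm_exp_ofReal_mul_I, mul_one]

theorem framelet_sub_gaussianFramelet {m ℓ : ℕ} (hm : 2 ≤ m) (h1 : 1 ≤ ℓ) (hl : ℓ ≤ m) (x : ℝ) :
    framelet m ℓ x - (gaussianFramelet m ℓ x : ℂ) =
      1 / (2 * Real.pi) * ∫ ω : ℝ, frameletDiffHat m ℓ ω * Complex.exp (Complex.I * ω * x) := by
  have e : ∀ ω : ℝ, Complex.I ^ ℓ * ((√(m.choose ℓ : ℝ) * ((ω / 4) ^ ℓ *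
      Real.exp (-((2 * m - ℓ) * (ω / 4) ^ 2 / 3))) : ℝ) : ℂ) *
        Complex.exp (Complex.I * ω * (x - parityShift m / 2 : ℝ)) =
      frameletHat m ℓ ω * Complex.exp (Complex.I * ω * x) -
        frameletDiffHat m ℓ ω * Complex.exp (Complex.I * ω * x) := by
    intro ω
    have : Complex.exp (Complex.I * ω * (x - parityShift m / 2 : ℝ)) =
        Complex.exp (-(Complex.I * ω * parityShift m / 2)) *
          Complex.exp (Complex.I * ω * x) := by
      rw [← Complex.exp_add]
      congr 1
      push_cast
      ring
    rw [this, frameletHat, frameletDiffHat, symbolDiff]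
    push_cast
    ring
  rw [gaussianFramelet, ofReal_iteratedDeriv_scaledGaussian (by omega) hl,
    integral_congr_ae (Eventually.of_forall e),
    integral_sub ((integrable_frameletHat hm ℓ).mul_exp_I_mul x)
      ((integrable_frameletDiffHat hm h1 hl).mul_exp_I_mul x), framelet]
  ring

theorem norm_framelet_sub_gaussianFramelet_le {m ℓ : ℕ} (hm : 2 ≤ m) (h1 : 1 ≤ ℓ) (hl : ℓ ≤ m)
    (x : ℝ) :
    ‖framelet m ℓ x - (gaussianFramelet m ℓ x : ℂ)‖ ≤
      4 * (2304 * √(Real.pi * 24) + 800 * Real.pi) / (m : ℝ) ^ (3 / 2 : ℝ) := by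
  have hI : ‖∫ ω : ℝ, frameletDiffHat m ℓ ω * Complex.exp (Complex.I * ω * x)‖ ≤
      4 * ∫ t, symbolMajorant m t := by
    refine (norm_integral_le_of_norm_le ((integrable_symbolMajorant hm).comp_div four_ne_zero)
      (Eventually.of_forall fun ω => ?_)).trans_eq ?_
    · rw [norm_mul, show Complex.I * (ω : ℂ) * x = ((ω * x : ℝ) : ℂ) * Complex.I by
        push_cast; ring, Complex.norm_exp_ofReal_mul_I, mul_one, norm_frameletDiffHat]
      exact abs_symbolDiff_le_symbolMajorant hm h1 hl _
    · rw [Measure.integral_comp_div (symbolMajorant m) 4, smul_eq_mul, abs_of_pos four_pos]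
  have hpi : ‖(1 / (2 * Real.pi) : ℂ)‖ ≤ 1 := by
    rw [show (1 / (2 * Real.pi) : ℂ) = ((1 / (2 * Real.pi) : ℝ) : ℂ) by push_cast; ring,
      Complex.norm_real, Real.norm_of_nonneg (by positivity), div_le_one (by positivity)]
    linarith [Real.pi_gt_three]
  rw [framelet_sub_gaussianFramelet hm h1 hl, norm_mul]
  refine (mul_le_of_le_one_left (norm_nonneg _) hpi).trans (hI.trans ?_)
  rw [mul_div_assoc]
  exact mul_le_mul_of_nonneg_left (integral_symbolMajorant_le hm) four_pos.le

/-! ### Attainment of the maximum and conclusion -/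

theorem Continuous.exists_forall_norm_ge_of_tendsto_zero {f : ℝ → ℂ} (hf : Continuous f)
    (h0 : Tendsto f (cocompact ℝ) (𝓝 0)) : ∃ x, ∀ y, ‖f y‖ ≤ ‖f x‖ := by
  by_cases h : ∃ x, f x ≠ 0
  · obtain ⟨x, hx⟩ := h
    have hlim := h0.norm
    rw [norm_zero] at hlim
    exact hf.norm.exists_forall_ge' x
      ((hlim.eventually (gt_mem_nhds (norm_pos_iff.2 hx))).mono fun y hy => hy.le)
  · push Not at h
    exact ⟨0, fun y => by simp [h]⟩

theorem exists_forall_norm_framelet_sub_le {m ℓ : ℕ} (hm : 2 ≤ m) (h1 : 1 ≤ ℓ) (hl : ℓ ≤ m) :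
    ∃ x, ∀ y, ‖framelet m ℓ y - (gaussianFramelet m ℓ y : ℂ)‖ ≤
      ‖framelet m ℓ x - (gaussianFramelet m ℓ x : ℂ)‖ := by
  have e : (fun x : ℝ => framelet m ℓ x - (gaussianFramelet m ℓ x : ℂ)) =
      𝓕 (fun v : ℝ => frameletDiffHat m ℓ (-2 * Real.pi * v)) := by
    ext x
    rw [framelet_sub_gaussianFramelet hm h1 hl, inverse_fourier_integral_eq_fourier]
  have hint : Integrable fun v : ℝ => frameletDiffHat m ℓ (-2 * Real.pi * v) :=
    (integrable_frameletDiffHat hm h1 hl).comp_mul_left' (by simp [Real.pi_ne_zero])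
  refine Continuous.exists_forall_norm_ge_of_tendsto_zero
    (f := fun x : ℝ => framelet m ℓ x - (gaussianFramelet m ℓ x : ℂ)) ?_ ?_
  · rw [e]
    exact VectorFourier.fourierIntegral_continuous Real.continuous_fourierChar
      (by exact continuous_inner) hint
  · rw [e]
    exact Real.zero_at_infty_fourier _

/-- The proof gives the bound `O(m^{-3/2})`; the logarithm is only bounded below by `log 2`. -/
theorem mainTheorem2 :
    ∃ C : ℝ, 0 < C ∧ ∀ m : ℕ, 2 ≤ m → ∃ M : ℝ,
      IsGreatest
        {r : ℝ | ∃ (ℓ : ℕ) (x : ℝ), 1 ≤ ℓ ∧ ℓ ≤ m ∧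
          r = ‖framelet m ℓ x - (gaussianFramelet m ℓ x : ℂ)‖} M ∧
      M ≤ C * (Real.log m ^ (5 / 2 : ℝ) / (m : ℝ) ^ (3 / 2 : ℝ)) := by
  have hlog2 : 0 < Real.log 2 := Real.log_pos one_lt_two
  refine ⟨4 * (2304 * √(Real.pi * 24) + 800 * Real.pi) / Real.log 2 ^ (5 / 2 : ℝ), by positivity,
    fun m hm => ?_⟩
  choose! x hx using fun ℓ (h : ℓ ∈ Finset.Icc 1 m) =>
    exists_forall_norm_framelet_sub_le hm (Finset.mem_Icc.1 h).1 (Finset.mem_Icc.1 h).2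
  obtain ⟨k, hk, hmax⟩ := (Finset.Icc 1 m).exists_max_image
    (fun ℓ => ‖framelet m ℓ (x ℓ) - (gaussianFramelet m ℓ (x ℓ) : ℂ)‖)
    ⟨1, Finset.mem_Icc.2 ⟨le_rfl, by omega⟩⟩
  have hk' := Finset.mem_Icc.1 hk
  refine ⟨_, ⟨⟨k, x k, hk'.1, hk'.2, rfl⟩, ?_⟩, ?_⟩
  · rintro r ⟨ℓ, y, h1, hl, rfl⟩
    have hmem := Finset.mem_Icc.2 ⟨h1, hl⟩
    exact (hx ℓ hmem y).trans (hmax ℓ hmem)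
  · refine (norm_framelet_sub_gaussianFramelet_le hm hk'.1 hk'.2 _).trans ?_
    have hlog : Real.log 2 ^ (5 / 2 : ℝ) ≤ Real.log m ^ (5 / 2 : ℝ) := by
      refine Real.rpow_le_rpow hlog2.le (Real.log_le_log two_pos ?_) (by norm_num)
      exact_mod_cast hm
    rw [← mul_div_assoc]
    refine div_le_div_of_nonneg_right ?_ (by positivity)
    rw [div_mul_eq_mul_div, le_div_iff₀ (by positivity)]
    exact mul_le_mul_of_nonneg_left hlog (by positivity)
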